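/- Let $H$ be a separable complex Hilbert space. Let $\mathcal{BF}^{\mathrm{sa}}$ be the set of bounded self-adjoint Fredholm operators on $H$ and $G\mathcal{B}^{\mathrm{sa}}\subset\mathcal{BF}^{\mathrm{sa}}$ the subset of bounded self-adjoint invertible operators, both with the operator norm topology. Let $\mathcal{CF}^{\mathrm{sa}}$ be the set of (not necessarily bounded, densely defined) self-adjoint Fredholm operators in $H$, and $G\mathcal{C}^{\mathrm{sa}}\subset\mathcal{CF}^{\mathrm{sa}}$ the subset of those that are invertible, i.e. that have a bounded everywhere defined inverse. Here an operator is called Fredholm if its kernel is finite dimensional and its range is closed and of finite codimension. Equip $\mathcal{CF}^{\mathrm{sa}}$ and $G\mathcal{C}^{\mathrm{sa}}$ with the Riesz metric $$d_R(T_1,T_2)=\|F(T_1)-F(T_2)\|,\qquad F(T)=T(I+T^2)^{-1/2}.$$ Then the natural inclusion of pairs $$j:\bigl(\mathcal{BF}^{\mathrm{sa}},G\mathcal{B}^{\mathrm{sa}}\bigr)\hookrightarrow\bigl((\mathcal{CF}^{\mathrm{sa}},G\mathcal{C}^{\mathrm{sa}}),d_R\bigr)$$ is a homotopy equivalence of pairs: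 $j$ is continuous, and there is a continuous map $g:\mathcal{CF}^{\mathrm{sa}}\to\mathcal{BF}^{\mathrm{sa}}$ with $g(G\mathcal{C}^{\mathrm{sa}})\subset G\mathcal{B}^{\mathrm{sa}}$ such that $g\circ j$ and $j\circ g$ are homotopic to the respective identity maps through maps of pairs. -/

import Mathlib

open Set

noncomputable section

namespace RieszFredholm

/-! ### Homotopy equivalences of pairs of spaces -/

/-- A map `j : X → Y` is a homotopy equivalence of pairs `(X, A) → (Y, B)`: it is continuous, maps
`A` into `B`, and there is a continuous map `g : Y → X` with `g(B) ⊆ A` such that `g ∘ j` and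
`j ∘ g` are homotopic to the identities through maps of pairs `(X, A) → (X, A)` and
`(Y, B) → (Y, B)`, respectively. -/
def IsPairHomotopyEquiv {X Y : Type*} [TopologicalSpace X] [TopologicalSpace Y]
    (A : Set X) (B : Set Y) (j : X → Y) : Prop :=
  ∃ f : C(X, Y), (∀ x, f x = j x) ∧ MapsTo f A B ∧
    ∃ g : C(Y, X), MapsTo g B A ∧
      (g.comp f).HomotopicWith (ContinuousMap.id X) (fun h => MapsTo h A A) ∧
      (f.comp g).HomotopicWith (ContinuousMap.id Y) (fun h => MapsTo h B B)

variable {H : Type*} [NormedAddCommGroup H] [InnerProductSpace ℂ H]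

/-! ### Fredholm and invertible unbounded operators -/

/-- A partially defined operator is Fredholm if its kernel is finite dimensional and its range is
closed and of finite codimension. (It is applied to closed, densely defined operators.) -/
structure IsFredholmOp (T : H →ₗ.[ℂ] H) : Prop where
  finite_ker : FiniteDimensional ℂ (LinearMap.ker T.toFun)
  isClosed_range : IsClosed (LinearMap.range T.toFun : Set H)
  finite_coker : FiniteDimensional ℂ (H ⧸ LinearMap.range T.toFun)

/-- A partially defined operator `T` is invertible if it has a bounded, everywhere defined
two-sided inverse `S : H → D(T)`. -/
def IsInvertibleOp (T : H →ₗ.[ℂ] H) : Prop :=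
  ∃ S : H →L[ℂ] H, (∀ x : T.domain, S (T x) = x) ∧
    ∀ y : H, ∃ h : S y ∈ T.domain, T ⟨S y, h⟩ = y

theorem IsInvertibleOp.isFredholmOp {T : H →ₗ.[ℂ] H} (hT : IsInvertibleOp T) :
    IsFredholmOp T := by
  obtain ⟨S, h1, h2⟩ := hT
  have hk : LinearMap.ker T.toFun = ⊥ := by
    rw [LinearMap.ker_eq_bot']
    intro x hx
    have h := h1 x
    rw [← LinearPMap.toFun_eq_coe, hx, map_zero] at h
    exact Subtype.ext h.symm
  have hr : LinearMap.range T.toFun = ⊤ := by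
    rw [LinearMap.range_eq_top]
    exact fun y => ⟨_, (h2 y).2⟩
  refine ⟨by rw [hk]; infer_instance, by rw [hr]; exact isClosed_univ, ?_⟩
  rw [hr]
  infer_instance

variable [CompleteSpace H]

/-! ### The Riesz transform of a self-adjoint operator -/

theorem inner_symm_of_isSelfAdjoint {T : H →ₗ.[ℂ] H} (hT : IsSelfAdjoint T) (x y : T.domain) :
    inner ℂ (T x) (y : H) = inner ℂ (x : H) (T y) := by
  have h := LinearPMap.adjoint_isFormalAdjoint hT.dense_domain
  rw [LinearPMap.isSelfAdjoint_def.mp hT] at h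
  exact h x y

/-- `R` is the inverse of `I + T²`, where `T²` has the domain `{x ∈ D(T) | T x ∈ D(T)}`. -/
structure IsInvOneAddSq (T : H →ₗ.[ℂ] H) (R : H →L[ℂ] H) : Prop where
  right_inv : ∀ x : H, ∃ (h : R x ∈ T.domain) (h' : T ⟨R x, h⟩ ∈ T.domain),
    R x + T ⟨T ⟨R x, h⟩, h'⟩ = x
  left_inv : ∀ (y : T.domain) (h : T y ∈ T.domain), R ((y : H) + T ⟨T y, h⟩) = y

theorem exists_decomp {T : H →ₗ.[ℂ] H} (hT : IsSelfAdjoint T) (x : H) :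
    ∃ (y : T.domain) (h : T y ∈ T.domain), (y : H) + T ⟨T y, h⟩ = x := by
  set G : Submodule ℂ (WithLp 2 (H × H)) :=
    T.graph.map (WithLp.linearEquiv 2 ℂ (H × H)).symm.toLinearMap with hG
  have hGc : IsClosed (G : Set (WithLp 2 (H × H))) := by
    have := hT.isClosed
    rw [LinearPMap.IsClosed] at this
    rw [hG, Submodule.map_coe, LinearEquiv.coe_coe, LinearEquiv.image_eq_preimage_symm]
    exact this.preimage (WithLp.prod_continuous_ofLp _ _ _)
  have : CompleteSpace G := hGc.completeSpace_coe
  obtain ⟨p, hp, q, hq, hpq⟩ := Submodule.exists_add_mem_mem_orthogonal (K := G)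
    (WithLp.toLp 2 (x, (0 : H)))
  obtain ⟨p', hp', rfl⟩ := hp
  obtain ⟨y, hy1, hy2⟩ := (LinearPMap.mem_graph_iff T).mp hp'
  have e1 : x = p'.1 + q.fst := congrArg (fun z : WithLp 2 (H × H) => z.fst) hpq
  have e2 : (0 : H) = p'.2 + q.snd := congrArg (fun z : WithLp 2 (H × H) => z.snd) hpq
  have hq' : ∀ z : T.domain, inner ℂ q.fst (z : H) = inner ℂ (-q.snd) (T z) := by
    intro z
    have := (Submodule.mem_orthogonal' G q).mp hq (WithLp.toLp 2 ((z : H), T z))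
      ⟨((z : H), T z), T.mem_graph z, rfl⟩
    rw [WithLp.prod_inner_apply] at this
    rw [inner_neg_left]
    exact eq_neg_of_add_eq_zero_left this
  have e3 : -q.snd = T y := by rw [hy2]; exact neg_eq_of_add_eq_zero_left e2.symm
  rw [e3] at hq'
  have hm : T y ∈ T.adjoint.domain := LinearPMap.mem_adjoint_domain_of_exists _ ⟨q.fst, hq'⟩
  have hv : T.adjoint ⟨T y, hm⟩ = q.fst := LinearPMap.adjoint_apply_eq hT.dense_domain _ hq'
  have hTT : T.adjoint = T := hT
  have key : ∀ S : H →ₗ.[ℂ] H, S = T → ∀ h : T y ∈ S.domain, S ⟨T y, h⟩ = q.fst →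
      ∃ h : T y ∈ T.domain, T ⟨T y, h⟩ = q.fst := by
    rintro S rfl h h'
    exact ⟨h, h'⟩
  obtain ⟨h, h'⟩ := key _ hTT hm hv
  exact ⟨y, h, by rw [h', e1, hy1]⟩

theorem inner_decomp {T : H →ₗ.[ℂ] H} (hT : IsSelfAdjoint T) (y : T.domain)
    (h : T y ∈ T.domain) :
    inner ℂ ((y : H) + T ⟨T y, h⟩) (y : H) = ((‖(y : H)‖ ^ 2 + ‖T y‖ ^ 2 : ℝ) : ℂ) := by
  rw [inner_add_left, inner_symm_of_isSelfAdjoint hT ⟨T y, h⟩ y]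
  simp [inner_self_eq_norm_sq_to_K]

theorem norm_le_of_decomp {T : H →ₗ.[ℂ] H} (hT : IsSelfAdjoint T) (y : T.domain)
    (h : T y ∈ T.domain) : ‖(y : H)‖ ≤ ‖(y : H) + T ⟨T y, h⟩‖ := by
  have h1 := norm_inner_le_norm (𝕜 := ℂ) ((y : H) + T ⟨T y, h⟩) (y : H)
  rw [inner_decomp hT, Complex.norm_real, Real.norm_of_nonneg (by positivity)] at h1
  by_contra hc
  push Not at hc
  have h0 : 0 < ‖(y : H)‖ := lt_of_le_of_lt (norm_nonneg _) hc
  nlinarith [sq_nonneg ‖T y‖]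

theorem exists_isInvOneAddSq {T : H →ₗ.[ℂ] H} (hT : IsSelfAdjoint T) :
    ∃ R : H →L[ℂ] H, IsInvOneAddSq T R := by
  have uniq : ∀ (y y' : T.domain) (h : T y ∈ T.domain) (h' : T y' ∈ T.domain),
      (y : H) + T ⟨T y, h⟩ = (y' : H) + T ⟨T y', h'⟩ → y = y' := by
    intro y y' h h' e
    have hm : T (y - y') ∈ T.domain := by
      rw [LinearPMap.map_sub]
      exact T.domain.sub_mem h h'
    have hz : T ⟨T (y - y'), hm⟩ = T ⟨T y, h⟩ - T ⟨T y', h'⟩ := by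
      rw [← LinearPMap.map_sub]
      congr 1
      exact Subtype.ext (LinearPMap.map_sub _ _ _)
    have hn := norm_le_of_decomp hT (y - y') hm
    have h0 : ((y - y' : T.domain) : H) + T ⟨T (y - y'), hm⟩ = 0 := by
      rw [hz, Submodule.coe_sub, sub_add_sub_comm, e, sub_self]
    rw [h0, norm_zero] at hn
    have := norm_le_zero_iff.mp hn
    rw [Submodule.coe_sub] at this
    exact Subtype.ext (sub_eq_zero.mp this)
  choose r hr hr' using exists_decomp hT
  refine ⟨LinearMap.mkContinuous
    { toFun := fun x => (r x : H)
      map_add' := ?_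
      map_smul' := ?_ } 1 ?_, ?_, ?_⟩
  · intro x x'
    have hm : T (r x + r x') ∈ T.domain := by
      rw [LinearPMap.map_add]
      exact T.domain.add_mem (hr x) (hr x')
    have hz : T ⟨T (r x + r x'), hm⟩ = T ⟨T (r x), hr x⟩ + T ⟨T (r x'), hr x'⟩ := by
      rw [← LinearPMap.map_add]
      congr 1
      exact Subtype.ext (LinearPMap.map_add _ _ _)
    have := uniq (r (x + x')) (r x + r x') (hr _) hm (by
      rw [hr', hz, Submodule.coe_add, add_add_add_comm, hr', hr'])
    rw [this, Submodule.coe_add]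
  · intro c x
    have hm : T (c • r x) ∈ T.domain := by
      rw [LinearPMap.map_smul]
      exact T.domain.smul_mem c (hr x)
    have hz : T ⟨T (c • r x), hm⟩ = c • T ⟨T (r x), hr x⟩ := by
      rw [← LinearPMap.map_smul]
      congr 1
      exact Subtype.ext (LinearPMap.map_smul _ _ _)
    have := uniq (r (c • x)) (c • r x) (hr _) hm (by
      rw [hr', hz, Submodule.coe_smul, ← smul_add, hr'])
    rw [this, Submodule.coe_smul, RingHom.id_apply]
  · intro x
    have := norm_le_of_decomp hT (r x) (hr x)
    rw [hr'] at this
    simpa using this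
  · exact fun x => ⟨(r x).2, hr x, hr' x⟩
  · intro y h
    exact congrArg Subtype.val (uniq _ y (hr _) h (hr' _))

/-- The bounded operator `(I + T²)⁻¹` for a self-adjoint operator `T`. -/
def invOneAddSq (T : H →ₗ.[ℂ] H) (hT : IsSelfAdjoint T) : H →L[ℂ] H :=
  (exists_isInvOneAddSq hT).choose

theorem isInvOneAddSq_invOneAddSq {T : H →ₗ.[ℂ] H} (hT : IsSelfAdjoint T) :
    IsInvOneAddSq T (invOneAddSq T hT) :=
  (exists_isInvOneAddSq hT).choose_spec

theorem invOneAddSq_nonneg {T : H →ₗ.[ℂ] H} (hT : IsSelfAdjoint T) : 0 ≤ invOneAddSq T hT := by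
  rw [ContinuousLinearMap.nonneg_iff_isPositive, ContinuousLinearMap.isPositive_iff_complex]
  intro x
  obtain ⟨h, h', e⟩ := (isInvOneAddSq_invOneAddSq hT).right_inv x
  have h1 := inner_decomp hT ⟨_, h⟩ h'
  rw [e] at h1
  rw [← inner_conj_symm, h1]
  simp only [Complex.conj_ofReal, RCLike.re_to_complex, Complex.ofReal_re, true_and]
  positivity

/-- The bounded operator `(I + T²)^{-1/2}`, the nonnegative square root of `(I + T²)⁻¹`. -/
def invSqrtOneAddSq (T : H →ₗ.[ℂ] H) (hT : IsSelfAdjoint T) : H →L[ℂ] H :=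
  CFC.sqrt (invOneAddSq T hT)

theorem norm_inner_invSqrt_le {T : H →ₗ.[ℂ] H} (hT : IsSelfAdjoint T) (v : H) (y : T.domain) :
    ‖inner ℂ (invSqrtOneAddSq T hT v) (T y)‖ ≤ ‖v‖ * ‖(y : H)‖ := by
  set A := invSqrtOneAddSq T hT with hA
  set R := invOneAddSq T hT with hR
  have hAA : ∀ u, A (A u) = R u := fun u => by
    rw [← mul_apply_eq_comp, hA, invSqrtOneAddSq,
      CFC.sqrt_mul_sqrt_self _ (invOneAddSq_nonneg hT)]
  have hAs : IsSelfAdjoint A := (CFC.sqrt_nonneg _).isSelfAdjoint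
  have hAi : ∀ u w, inner ℂ (A u) w = inner ℂ u (A w) := fun u w => by
    have := hAs.isSymmetric u w
    exact this
  have hdense : DenseRange A := by
    have : (LinearMap.range (A : H →ₗ[ℂ] H))ᗮ = ⊥ := by
      rw [Submodule.eq_bot_iff]
      intro w hw
      have hAw : A w = 0 := by
        rw [← inner_self_eq_zero (𝕜 := ℂ), hAi]
        exact (Submodule.mem_orthogonal' _ _).mp hw _ ⟨A w, rfl⟩
      have hRw : R w = 0 := by rw [← hAA, hAw, map_zero]
      obtain ⟨h, h', e⟩ := (isInvOneAddSq_invOneAddSq hT).right_inv w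
      have h0 : (⟨R w, h⟩ : T.domain) = 0 := Subtype.ext hRw
      have h1 : (⟨T ⟨R w, h⟩, h'⟩ : T.domain) = 0 := by
        refine Subtype.ext ?_
        change T ⟨R w, h⟩ = 0
        rw [h0, LinearPMap.map_zero]
      rw [← e]
      change R w + T ⟨T ⟨R w, h⟩, h'⟩ = 0
      rw [h1, hRw, LinearPMap.map_zero, add_zero]
    have h2 := (Submodule.topologicalClosure_eq_top_iff).mpr this
    exact (Submodule.dense_iff_topologicalClosure_eq_top).mpr h2
  refine hdense.induction_on (p := fun v => ‖inner ℂ (A v) (T y)‖ ≤ ‖v‖ * ‖(y : H)‖) v ?_ ?_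
  · exact isClosed_le (by fun_prop) (by fun_prop)
  · intro u
    rw [hAA]
    obtain ⟨h, h', e⟩ := (isInvOneAddSq_invOneAddSq hT).right_inv u
    have h1 := inner_decomp hT ⟨_, h⟩ h'
    rw [e] at h1
    have h2 : ‖A u‖ ^ 2 = ‖R u‖ ^ 2 + ‖T ⟨R u, h⟩‖ ^ 2 := by
      have h3 : inner ℂ u (R u) = ((‖A u‖ ^ 2 : ℝ) : ℂ) := by
        rw [← hAA, ← hAi, inner_self_eq_norm_sq_to_K]
        simp
      rw [h3] at h1
      exact_mod_cast h1
    have h4 : ‖T ⟨R u, h⟩‖ ≤ ‖A u‖ := by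
      refine (sq_le_sq₀ (norm_nonneg _) (norm_nonneg _)).mp ?_
      rw [h2]
      nlinarith [sq_nonneg ‖R u‖]
    have h5 := inner_symm_of_isSelfAdjoint hT ⟨R u, h⟩ y
    change ‖inner ℂ ((⟨R u, h⟩ : T.domain) : H) (T y)‖ ≤ _
    rw [← h5]
    exact (norm_inner_le_norm _ _).trans (by gcongr)

/-- `(I + T²)^{-1/2}` maps `H` into the domain of `T`. -/
theorem invSqrtOneAddSq_mem {T : H →ₗ.[ℂ] H} (hT : IsSelfAdjoint T) (v : H) :
    invSqrtOneAddSq T hT v ∈ T.domain := by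
  have h : invSqrtOneAddSq T hT v ∈ T.adjoint.domain := by
    rw [LinearPMap.mem_adjoint_domain_iff]
    exact AddMonoidHomClass.continuous_of_bound _ ‖v‖ fun y => norm_inner_invSqrt_le hT v y
  rwa [LinearPMap.isSelfAdjoint_def.mp hT] at h

theorem norm_apply_invSqrt_le {T : H →ₗ.[ℂ] H} (hT : IsSelfAdjoint T) (v : H) :
    ‖T ⟨invSqrtOneAddSq T hT v, invSqrtOneAddSq_mem hT v⟩‖ ≤ ‖v‖ := by
  set w := T ⟨invSqrtOneAddSq T hT v, invSqrtOneAddSq_mem hT v⟩ with hw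
  have h1 : ∀ y : H, ‖inner ℂ w y‖ ≤ ‖v‖ * ‖y‖ := by
    intro y
    refine hT.dense_domain.induction (P := fun y => ‖inner ℂ w y‖ ≤ ‖v‖ * ‖y‖) ?_ ?_ y
    · intro y hy
      have := inner_symm_of_isSelfAdjoint hT
        ⟨invSqrtOneAddSq T hT v, invSqrtOneAddSq_mem hT v⟩ ⟨y, hy⟩
      rw [← hw] at this
      change inner ℂ w y = _ at this
      rw [this]
      exact norm_inner_invSqrt_le hT v ⟨y, hy⟩
    · exact isClosed_le (by fun_prop) (by fun_prop)
  have h2 := h1 w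
  rw [inner_self_eq_norm_sq_to_K] at h2
  simp only [norm_pow, RCLike.norm_ofReal, abs_norm] at h2
  by_contra hc
  push Not at hc
  nlinarith [norm_nonneg v, norm_nonneg w]

/-- The Riesz transform `F(T) = T (I + T²)^{-1/2}` of a self-adjoint operator `T`, a bounded
operator on `H`. -/
def rieszTransform (T : H →ₗ.[ℂ] H) (hT : IsSelfAdjoint T) : H →L[ℂ] H :=
  LinearMap.mkContinuous
    { toFun := fun v => T ⟨invSqrtOneAddSq T hT v, invSqrtOneAddSq_mem hT v⟩
      map_add' := fun v w => by
        rw [← LinearPMap.map_add]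
        congr 1
        exact Subtype.ext (map_add _ _ _)
      map_smul' := fun c v => by
        rw [RingHom.id_apply, ← LinearPMap.map_smul]
        congr 1
        exact Subtype.ext (map_smul _ _ _) } 1
    (fun v => by simpa using norm_apply_invSqrt_le hT v)

/-! ### The spaces of self-adjoint Fredholm operators -/

variable (H)

/-- The space of bounded self-adjoint Fredholm operators on `H`; as a subtype of `H →L[ℂ] H` it
carries the operator norm topology. -/
abbrev BoundedFredholmSA : Type _ :=
  {T : H →L[ℂ] H // IsSelfAdjoint T ∧ T.IsFredholm}

/-- The bounded self-adjoint invertible operators, as a subset of the bounded self-adjoint Fredholm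
operators. -/
def boundedInvertibleSA : Set (BoundedFredholmSA H) := {T | IsUnit T.1}

/-- Bounded invertible operators are Fredholm. -/
theorem isFredholm_of_isUnit {T : H →L[ℂ] H} (hT : IsUnit T) : T.IsFredholm := by
  obtain ⟨u, rfl⟩ := hT
  have h1 : ∀ x, (u : H →L[ℂ] H) ((↑u⁻¹ : H →L[ℂ] H) x) = x := fun x =>
    congrArg (fun S : H →L[ℂ] H => S x) u.mul_inv
  have h2 : ∀ x, (↑u⁻¹ : H →L[ℂ] H) ((u : H →L[ℂ] H) x) = x := fun x =>
    congrArg (fun S : H →L[ℂ] H => S x) u.inv_mul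
  refine ContinuousLinearMap.IsFredholm.of_isQuasiInverse (v := (↑u⁻¹ : H →L[ℂ] H)) ?_
  have e1 : ((↑u⁻¹ : H →L[ℂ] H) : H →ₗ[ℂ] H) ∘ₗ ((u : H →L[ℂ] H) : H →ₗ[ℂ] H) = LinearMap.id :=
    LinearMap.ext h2
  have e2 : ((u : H →L[ℂ] H) : H →ₗ[ℂ] H) ∘ₗ ((↑u⁻¹ : H →L[ℂ] H) : H →ₗ[ℂ] H) = LinearMap.id :=
    LinearMap.ext h1
  constructor
  · rw [LinearMap.IsLeftQuasiInverse, e1]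
  · rw [LinearMap.IsRightQuasiInverse, e2]

/-- The set of (not necessarily bounded) self-adjoint Fredholm operators in `H`. Self-adjoint
operators are automatically closed and densely defined. -/
def ClosedFredholmSA : Type _ :=
  {T : H →ₗ.[ℂ] H // IsSelfAdjoint T ∧ IsFredholmOp T}

/-- The Riesz metric `d(T₁, T₂) = ‖F(T₁) - F(T₂)‖`. -/
instance : PseudoMetricSpace (ClosedFredholmSA H) :=
  PseudoMetricSpace.induced (fun T => rieszTransform T.1 T.2.1) inferInstance

/-- The (not necessarily bounded) self-adjoint invertible operators, as a subset of the
self-adjoint Fredholm operators. -/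
def closedInvertibleSA : Set (ClosedFredholmSA H) := {T | IsInvertibleOp T.1}

variable {H}

theorem isSelfAdjoint_toPMap {T : H →L[ℂ] H} (hT : IsSelfAdjoint T) :
    IsSelfAdjoint ((T : H →ₗ[ℂ] H).toPMap ⊤) := by
  rw [LinearPMap.isSelfAdjoint_def]
  have h := T.toPMap_adjoint_eq_adjoint_toPMap_of_dense (p := ⊤) (by simp)
  rwa [hT.adjoint_eq] at h

theorem isFredholmOp_toPMap {T : H →L[ℂ] H} (hT : T.IsFredholm) :
    IsFredholmOp ((T : H →ₗ[ℂ] H).toPMap ⊤) := by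
  have hr : LinearMap.range ((T : H →ₗ[ℂ] H).toPMap ⊤).toFun = LinearMap.range (T : H →ₗ[ℂ] H) := by
    ext y
    constructor
    · rintro ⟨x, rfl⟩
      exact ⟨x, rfl⟩
    · rintro ⟨x, rfl⟩
      exact ⟨⟨x, trivial⟩, rfl⟩
  refine ⟨?_, ?_, ?_⟩
  · have := hT.finite_ker
    refine FiniteDimensional.of_injective (V₂ := LinearMap.ker (T : H →ₗ[ℂ] H))
      (LinearMap.restrict (Submodule.subtype (⊤ : Submodule ℂ H)) (fun x hx => hx)) ?_
    intro x y hxy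
    have h : (x.1.1 : H) = y.1.1 :=
      congrArg (fun z : LinearMap.ker (T : H →ₗ[ℂ] H) => (z : H)) hxy
    exact Subtype.ext (Subtype.ext h)
  · rw [hr]
    exact hT.isClosed_range
  · rw [hr]
    exact hT.finite_coker

/-- The natural inclusion: a bounded operator is regarded as an operator with domain `H`. -/
def fredholmInclusion (T : BoundedFredholmSA H) : ClosedFredholmSA H :=
  ⟨(T.1 : H →ₗ[ℂ] H).toPMap ⊤, isSelfAdjoint_toPMap T.2.1, isFredholmOp_toPMap T.2.2⟩

end RieszFredholm

end

noncomputable section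

namespace RieszFredholm

open Set Topology

/-! ### Algebra of the Riesz transform of an unbounded self-adjoint operator. -/

section Unbounded

variable {H : Type*} [NormedAddCommGroup H] [InnerProductSpace ℂ H] [CompleteSpace H]

/-! The homotopy inverse is the Riesz transform `F` itself. With `A = (I + T²)^{-1/2}`, which is
injective with range `D(T)`, `F(T) = T A` is a self-adjoint contraction with the same range as `T`,
and `A` embeds its kernel into that of `T`; so `F` preserves being Fredholm and being invertible
(`isFredholm_rieszTransform`, `isUnit_rieszTransform`).

On bounded operators, `F` is the functional calculus of `x / √(1 + x²)` (`rieszTransform_toPMap`).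
The segment from `F(T)` to `T` is `T c_t(T)` with `c_t > 0`, hence `T` times a unit, and so stays in
the pair; this deforms `F ∘ j` to the identity.

For `j ∘ F`, put `S = F(T)`, whose spectrum lies in `[-1, 1]`. For `t < 1` the segment from `F(S)`
to `S` is given by a function with values in `(-1, 1)` there, so `y ↦ y / √(1 - y²)` lifts it to
bounded operators, again `S` times a unit. The lift starts at `S` and is completed by `T` at `t =
1`. Since the metric is pulled back along `F`, its continuity is just that of the segment
(`rieszTransform_liftHomotopy`). -/

theorem invOneAddSq_mem {T : H →ₗ.[ℂ] H} (hT : IsSelfAdjoint T) (v : H) :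
    invOneAddSq T hT v ∈ T.domain :=
  ((isInvOneAddSq_invOneAddSq hT).right_inv v).1

theorem invOneAddSq_injective {T : H →ₗ.[ℂ] H} (hT : IsSelfAdjoint T) :
    Function.Injective (invOneAddSq T hT) := by
  refine (injective_iff_map_eq_zero _).mpr fun w hRw => ?_
  obtain ⟨h, h', e⟩ := (isInvOneAddSq_invOneAddSq hT).right_inv w
  have h0 : (⟨invOneAddSq T hT w, h⟩ : T.domain) = 0 := Subtype.ext hRw
  have h1 : (⟨T ⟨invOneAddSq T hT w, h⟩, h'⟩ : T.domain) = 0 := by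
    refine Subtype.ext ?_
    change T ⟨invOneAddSq T hT w, h⟩ = 0
    rw [h0, LinearPMap.map_zero]
  rw [← e, h1, hRw, LinearPMap.map_zero, add_zero]

theorem invSqrtOneAddSq_mul_self {T : H →ₗ.[ℂ] H} (hT : IsSelfAdjoint T) :
    invSqrtOneAddSq T hT * invSqrtOneAddSq T hT = invOneAddSq T hT :=
  CFC.sqrt_mul_sqrt_self _ (invOneAddSq_nonneg hT)

theorem invSqrtOneAddSq_apply_apply {T : H →ₗ.[ℂ] H} (hT : IsSelfAdjoint T) (v : H) :
    invSqrtOneAddSq T hT (invSqrtOneAddSq T hT v) = invOneAddSq T hT v :=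
  congrArg (fun S : H →L[ℂ] H => S v) (invSqrtOneAddSq_mul_self hT)

theorem inner_invSqrtOneAddSq {T : H →ₗ.[ℂ] H} (hT : IsSelfAdjoint T) (v w : H) :
    inner ℂ (invSqrtOneAddSq T hT v) w = inner ℂ v (invSqrtOneAddSq T hT w) := by
  have h : IsSelfAdjoint (invSqrtOneAddSq T hT) := (CFC.sqrt_nonneg _).isSelfAdjoint
  exact h.isSymmetric v w

theorem invSqrtOneAddSq_injective {T : H →ₗ.[ℂ] H} (hT : IsSelfAdjoint T) :
    Function.Injective (invSqrtOneAddSq T hT) := by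
  intro v w h
  apply invOneAddSq_injective hT
  rw [← invSqrtOneAddSq_apply_apply, h, invSqrtOneAddSq_apply_apply]

theorem denseRange_invSqrtOneAddSq {T : H →ₗ.[ℂ] H} (hT : IsSelfAdjoint T) :
    DenseRange (invSqrtOneAddSq T hT) := by
  have h1 : (LinearMap.range (invSqrtOneAddSq T hT : H →ₗ[ℂ] H))ᗮ = ⊥ := by
    rw [Submodule.eq_bot_iff]
    intro w hw
    apply invSqrtOneAddSq_injective hT
    rw [map_zero, ← inner_self_eq_zero (𝕜 := ℂ), inner_invSqrtOneAddSq]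
    exact (Submodule.mem_orthogonal' _ _).mp hw _ ⟨invSqrtOneAddSq T hT w, rfl⟩
  have h2 := Submodule.topologicalClosure_eq_top_iff.mpr h1
  exact Submodule.dense_iff_topologicalClosure_eq_top.mpr h2

theorem rieszTransform_apply {T : H →ₗ.[ℂ] H} (hT : IsSelfAdjoint T) (v : H) :
    rieszTransform T hT v = T ⟨invSqrtOneAddSq T hT v, invSqrtOneAddSq_mem hT v⟩ :=
  rfl

theorem rieszTransform_invSqrtOneAddSq {T : H →ₗ.[ℂ] H} (hT : IsSelfAdjoint T) (v : H) :
    rieszTransform T hT (invSqrtOneAddSq T hT v) =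
      T ⟨invOneAddSq T hT v, invOneAddSq_mem hT v⟩ := by
  rw [rieszTransform_apply]
  congr 1
  exact Subtype.ext (invSqrtOneAddSq_apply_apply hT v)

/-- With `R = (I + T²)⁻¹`, the vector `T² R y = y - R y` lies in `D(T)` because `y` does. Hence `I +
T²` may be applied to `T R y` and gives `T y`. -/
theorem invOneAddSq_apply_map {T : H →ₗ.[ℂ] H} (hT : IsSelfAdjoint T) (y : T.domain) :
    invOneAddSq T hT (T y) = T ⟨invOneAddSq T hT y, invOneAddSq_mem hT y⟩ := by
  obtain ⟨h, h', e⟩ := (isInvOneAddSq_invOneAddSq hT).right_inv y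
  set R := invOneAddSq T hT
  have e1 : T ⟨T ⟨R y, h⟩, h'⟩ = (y - ⟨R y, h⟩ : T.domain) := eq_sub_of_add_eq' e
  have h3 : T ⟨T ⟨R y, h⟩, h'⟩ ∈ T.domain := by
    rw [e1]
    exact Subtype.prop _
  have e2 : T ⟨T ⟨T ⟨R y, h⟩, h'⟩, h3⟩ = T y - T ⟨R y, h⟩ := by
    rw [← LinearPMap.map_sub]
    congr 1
    exact Subtype.ext e1
  have := (isInvOneAddSq_invOneAddSq hT).left_inv ⟨T ⟨R y, h⟩, h'⟩ h3
  rw [e2] at this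
  simpa using this

/-- The bounded operator `T (I + T²)⁻¹ = F(T) (I + T²)^{-1/2}` is symmetric. -/
theorem inner_rieszTransform_invSqrt {T : H →ₗ.[ℂ] H} (hT : IsSelfAdjoint T) (v w : H) :
    inner ℂ (rieszTransform T hT (invSqrtOneAddSq T hT v)) w =
      inner ℂ v (rieszTransform T hT (invSqrtOneAddSq T hT w)) := by
  -- `R` commutes with `T` only on `D(T)`, so `w` is taken there first; both sides are continuous in
  -- `w`.
  refine hT.dense_domain.induction (P := fun w =>
    inner ℂ (rieszTransform T hT (invSqrtOneAddSq T hT v)) w =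
      inner ℂ v (rieszTransform T hT (invSqrtOneAddSq T hT w))) ?_ ?_ w
  · intro w hw
    rw [rieszTransform_invSqrtOneAddSq, rieszTransform_invSqrtOneAddSq]
    have h1 := inner_symm_of_isSelfAdjoint hT ⟨_, invOneAddSq_mem hT v⟩ ⟨w, hw⟩
    rw [h1, ← invOneAddSq_apply_map hT ⟨w, hw⟩]
    change inner ℂ (invOneAddSq T hT v) _ = _
    rw [← invSqrtOneAddSq_apply_apply, ← invSqrtOneAddSq_apply_apply, inner_invSqrtOneAddSq,
      inner_invSqrtOneAddSq]
  · exact isClosed_eq (by fun_prop) (by fun_prop)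

/-- `R` commutes with the bounded operator `T R = F(T) A`, and the functional calculus passes this
on to `A = √R`. -/
theorem commute_rieszTransform_mul_invSqrt {T : H →ₗ.[ℂ] H} (hT : IsSelfAdjoint T) :
    Commute (invSqrtOneAddSq T hT) (rieszTransform T hT * invSqrtOneAddSq T hT) := by
  have h : Commute (invOneAddSq T hT) (rieszTransform T hT * invSqrtOneAddSq T hT) := by
    ext v
    change invOneAddSq T hT (rieszTransform T hT (invSqrtOneAddSq T hT v)) =
      rieszTransform T hT (invSqrtOneAddSq T hT (invOneAddSq T hT v))
    rw [rieszTransform_invSqrtOneAddSq, rieszTransform_invSqrtOneAddSq, invOneAddSq_apply_map]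
  have h2 := h.cfc_nnreal NNReal.sqrt
  rwa [← CFC.sqrt_eq_cfc] at h2

/-- Cancels the right factor `A` in `A (F A) = (F A) A`, using that `A` has dense range. -/
theorem invSqrtOneAddSq_rieszTransform {T : H →ₗ.[ℂ] H} (hT : IsSelfAdjoint T) (v : H) :
    invSqrtOneAddSq T hT (rieszTransform T hT v) =
      rieszTransform T hT (invSqrtOneAddSq T hT v) := by
  refine (denseRange_invSqrtOneAddSq hT).induction_on (p := fun v =>
    invSqrtOneAddSq T hT (rieszTransform T hT v) =
      rieszTransform T hT (invSqrtOneAddSq T hT v)) v (isClosed_eq (by fun_prop) (by fun_prop)) ?_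
  intro u
  exact congrArg (fun S : H →L[ℂ] H => S u) (commute_rieszTransform_mul_invSqrt hT)

theorem isSelfAdjoint_rieszTransform {T : H →ₗ.[ℂ] H} (hT : IsSelfAdjoint T) :
    IsSelfAdjoint (rieszTransform T hT) := by
  rw [ContinuousLinearMap.isSelfAdjoint_iff_isSymmetric]
  intro v w
  change inner ℂ (rieszTransform T hT v) w = inner ℂ v (rieszTransform T hT w)
  refine (denseRange_invSqrtOneAddSq hT).induction_on (p := fun w =>
    inner ℂ (rieszTransform T hT v) w = inner ℂ v (rieszTransform T hT w)) w
    (isClosed_eq (by fun_prop) (by fun_prop)) fun u => ?_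
  rw [← inner_invSqrtOneAddSq, invSqrtOneAddSq_rieszTransform, inner_rieszTransform_invSqrt]

theorem norm_rieszTransform_le {T : H →ₗ.[ℂ] H} (hT : IsSelfAdjoint T) :
    ‖rieszTransform T hT‖ ≤ 1 :=
  LinearMap.mkContinuous_norm_le _ zero_le_one _

/-- An explicit preimage showing that `A` maps onto `D(T)`: the left side equals `R y + T R T y = R
y + T² R y = y`. -/
theorem invSqrtOneAddSq_add {T : H →ₗ.[ℂ] H} (hT : IsSelfAdjoint T) (y : T.domain) :
    invSqrtOneAddSq T hT (invSqrtOneAddSq T hT y + rieszTransform T hT (T y)) = y := by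
  obtain ⟨h, h', e⟩ := (isInvOneAddSq_invOneAddSq hT).right_inv y
  rw [map_add, invSqrtOneAddSq_apply_apply, invSqrtOneAddSq_rieszTransform,
    rieszTransform_invSqrtOneAddSq]
  refine Eq.trans ?_ e
  congr 2
  exact Subtype.ext (invOneAddSq_apply_map hT y)

theorem ker_rieszTransform {T : H →ₗ.[ℂ] H} (hT : IsSelfAdjoint T) (v : H) :
    v ∈ (rieszTransform T hT).ker ↔
      (⟨invSqrtOneAddSq T hT v, invSqrtOneAddSq_mem hT v⟩ : T.domain) ∈
        LinearMap.ker T.toFun :=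
  Iff.rfl

theorem range_rieszTransform {T : H →ₗ.[ℂ] H} (hT : IsSelfAdjoint T) :
    (rieszTransform T hT).range = LinearMap.range T.toFun := by
  ext z
  constructor
  · rintro ⟨v, rfl⟩
    exact ⟨⟨invSqrtOneAddSq T hT v, invSqrtOneAddSq_mem hT v⟩, rfl⟩
  · rintro ⟨y, rfl⟩
    refine ⟨invSqrtOneAddSq T hT y + rieszTransform T hT (T y), ?_⟩
    change T ⟨_, _⟩ = T y
    congr 1
    exact Subtype.ext (invSqrtOneAddSq_add hT y)

end Unbounded

/-! ### Fredholmness and invertibility under the Riesz transform. -/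

section Bounded

theorem isInvertibleOp_toPMap {H : Type*} [NormedAddCommGroup H] [InnerProductSpace ℂ H]
    {T : H →L[ℂ] H} (hT : IsUnit T) :
    IsInvertibleOp ((T : H →ₗ[ℂ] H).toPMap ⊤) := by
  obtain ⟨u, rfl⟩ := hT
  exact ⟨↑u⁻¹, fun x => congrArg (fun S : H →L[ℂ] H => S x) u.inv_mul,
    fun y => ⟨trivial, congrArg (fun S : H →L[ℂ] H => S y) u.mul_inv⟩⟩

/-- The open mapping theorem, applied to the map onto the range, which is a Banach space. -/
theorem isStrictMap_of_isClosed_range {𝕜 E F : Type*} [NontriviallyNormedField 𝕜]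
    [NormedAddCommGroup E] [NormedSpace 𝕜 E] [NormedAddCommGroup F] [NormedSpace 𝕜 F]
    [CompleteSpace E] [CompleteSpace F] {u : E →L[𝕜] F} (hu : IsClosed (u.range : Set F)) :
    IsStrictMap u := by
  have : CompleteSpace u.range := hu.completeSpace_coe
  change IsStrictMap (u : E →ₗ[𝕜] F)
  rw [LinearMap.isStrictMap_iff_isOpenQuotientMap_rangeRestrict]
  have h := u.surjective_rangeRestrict
  exact ⟨h, u.rangeRestrict.continuous, u.rangeRestrict.isOpenMap h⟩

variable {H : Type*} [NormedAddCommGroup H] [InnerProductSpace ℂ H] [CompleteSpace H]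

theorem isFredholm_rieszTransform {T : H →ₗ.[ℂ] H} (hT : IsSelfAdjoint T) (hF : IsFredholmOp T) :
    (rieszTransform T hT).IsFredholm := by
  have hc : IsClosed ((rieszTransform T hT).range : Set H) := by
    rw [range_rieszTransform]
    exact hF.isClosed_range
  have hk : FiniteDimensional ℂ (rieszTransform T hT).ker := by
    have := hF.finite_ker
    let A : (rieszTransform T hT).ker →ₗ[ℂ] LinearMap.ker T.toFun :=
      { toFun := fun v => ⟨⟨invSqrtOneAddSq T hT v, invSqrtOneAddSq_mem hT v⟩,
          (ker_rieszTransform hT v).mp v.2⟩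
        map_add' := fun v w => Subtype.ext (Subtype.ext (map_add _ _ _))
        map_smul' := fun c v => Subtype.ext (Subtype.ext (map_smul _ _ _)) }
    refine FiniteDimensional.of_injective A fun v w h => ?_
    exact Subtype.ext (invSqrtOneAddSq_injective hT
      (congrArg (fun z : LinearMap.ker T.toFun => (z.1 : H)) h))
  refine ⟨isStrictMap_of_isClosed_range hc, hc, hk, ?_, .of_finiteDimensional _⟩
  rw [range_rieszTransform]
  exact hF.finite_coker

theorem isUnit_rieszTransform {T : H →ₗ.[ℂ] H} (hT : IsSelfAdjoint T) (hI : IsInvertibleOp T) :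
    IsUnit (rieszTransform T hT) := by
  obtain ⟨S, h1, h2⟩ := hI
  rw [ContinuousLinearMap.isUnit_iff_bijective]
  constructor
  · intro v w h
    rw [rieszTransform_apply, rieszTransform_apply] at h
    have := congrArg S h
    rw [h1, h1] at this
    exact invSqrtOneAddSq_injective hT this
  · intro y
    have : y ∈ (rieszTransform T hT).range := by
      rw [range_rieszTransform]
      exact ⟨_, (h2 y).2⟩
    exact this

theorem isFredholm_mul_isUnit {T U : H →L[ℂ] H} (hT : T.IsFredholm) (hU : IsUnit U) :
    (T * U).IsFredholm := by
  obtain ⟨S, hS⟩ := hT.exists_isQuasiInverse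
  obtain ⟨V, hV⟩ := (isFredholm_of_isUnit H hU).exists_isQuasiInverse
  exact .of_isQuasiInverse (v := V * S) (hV.comp hS)

end Bounded

/-! ### The Riesz transform and the deformations as functional calculus. -/

section FunctionalCalculus

variable {H : Type*} [NormedAddCommGroup H] [InnerProductSpace ℂ H] [CompleteSpace H]

/-- The function `x ↦ x / √(1 + x²)` that defines the Riesz transform. -/
def rieszFun (x : ℝ) : ℝ := x * (√(1 + x ^ 2))⁻¹

theorem continuous_inv_sqrt_one_add_sq : Continuous fun x : ℝ => (√(1 + x ^ 2))⁻¹ := by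
  refine Continuous.inv₀ (by fun_prop) fun x => ?_
  positivity

theorem continuous_rieszFun : Continuous rieszFun :=
  continuous_id.mul continuous_inv_sqrt_one_add_sq

/-- One side is a right inverse of `1 + T²`, the other a left inverse. -/
theorem invOneAddSq_toPMap {T : H →L[ℂ] H} (hT : IsSelfAdjoint T) :
    invOneAddSq _ (isSelfAdjoint_toPMap hT) = cfc (fun x : ℝ => (1 + x ^ 2)⁻¹) T := by
  have h1 : (1 + T ^ 2) * invOneAddSq _ (isSelfAdjoint_toPMap hT) = 1 := by
    ext v
    obtain ⟨h, h', e⟩ := (isInvOneAddSq_invOneAddSq (isSelfAdjoint_toPMap hT)).right_inv v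
    exact e
  have h0 : ∀ x : ℝ, 1 + x ^ 2 ≠ 0 := fun x => by positivity
  have hc : Continuous fun x : ℝ => (1 + x ^ 2)⁻¹ := Continuous.inv₀ (by fun_prop) h0
  have h2 : cfc (fun x : ℝ => (1 + x ^ 2)⁻¹) T * (1 + T ^ 2) = 1 := by
    have e : cfc (fun x : ℝ => 1 + x ^ 2) T = 1 + T ^ 2 := by
      rw [cfc_add (a := T) (fun _ => (1 : ℝ)) (fun x => x ^ 2), cfc_const_one ℝ T, cfc_pow_id T 2]
    rw [← e, ← cfc_mul _ _ T hc.continuousOn (by fun_prop), ← cfc_const_one ℝ T]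
    exact cfc_congr fun x _ => inv_mul_cancel₀ (h0 x)
  exact (left_inv_eq_right_inv h2 h1).symm

theorem invSqrtOneAddSq_toPMap {T : H →L[ℂ] H} (hT : IsSelfAdjoint T) :
    invSqrtOneAddSq _ (isSelfAdjoint_toPMap hT) = cfc (fun x : ℝ => (√(1 + x ^ 2))⁻¹) T := by
  rw [invSqrtOneAddSq]
  refine CFC.sqrt_unique ?_ (cfc_nonneg fun x _ => by positivity)
  rw [invOneAddSq_toPMap hT, ← cfc_mul _ _ T continuous_inv_sqrt_one_add_sq.continuousOn
    continuous_inv_sqrt_one_add_sq.continuousOn]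
  refine cfc_congr fun x _ => ?_
  change (√(1 + x ^ 2))⁻¹ * (√(1 + x ^ 2))⁻¹ = _
  rw [← mul_inv, Real.mul_self_sqrt (by positivity)]

theorem rieszTransform_toPMap {T : H →L[ℂ] H} (hT : IsSelfAdjoint T) :
    rieszTransform _ (isSelfAdjoint_toPMap hT) = cfc rieszFun T := by
  have h : rieszTransform _ (isSelfAdjoint_toPMap hT) =
      T * invSqrtOneAddSq _ (isSelfAdjoint_toPMap hT) := rfl
  rw [h, invSqrtOneAddSq_toPMap hT]
  nth_rewrite 1 [← cfc_id' ℝ T]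
  rw [← cfc_mul _ _ T (by fun_prop) continuous_inv_sqrt_one_add_sq.continuousOn]
  rfl

/-- The reason why both deformations are written as `x * k x`: where `k` has no zero on the
spectrum, `cfc k T` is a unit, so multiplying by it preserves Fredholmness and invertibility. -/
theorem cfc_id_mul {T : H →L[ℂ] H} (hT : IsSelfAdjoint T) {k : ℝ → ℝ}
    (hk : ContinuousOn k (spectrum ℝ T)) : cfc (fun x => x * k x) T = T * cfc k T := by
  rw [cfc_mul (fun x => x) k T (by fun_prop) hk, cfc_id' ℝ T]

theorem isFredholm_cfc_id_mul {T : H →L[ℂ] H} (hT : IsSelfAdjoint T) (hF : T.IsFredholm)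
    {k : ℝ → ℝ} (hk : ContinuousOn k (spectrum ℝ T)) (h0 : ∀ x ∈ spectrum ℝ T, k x ≠ 0) :
    (cfc (fun x => x * k x) T).IsFredholm := by
  rw [cfc_id_mul hT hk]
  exact isFredholm_mul_isUnit hF ((isUnit_cfc_iff k T).mpr h0)

theorem isUnit_cfc_id_mul {T : H →L[ℂ] H} (hT : IsSelfAdjoint T) (hU : IsUnit T)
    {k : ℝ → ℝ} (hk : ContinuousOn k (spectrum ℝ T)) (h0 : ∀ x ∈ spectrum ℝ T, k x ≠ 0) :
    IsUnit (cfc (fun x => x * k x) T) := by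
  rw [cfc_id_mul hT hk]
  exact hU.mul ((isUnit_cfc_iff k T).mpr h0)

/-- The functions `c_t(x) = t + (1 - t) / √(1 + x²)`, for which `x ↦ x c_t(x)` is the straight line
from `x / √(1 + x²)` to `x`. -/
def lineFactor (t x : ℝ) : ℝ := t + (1 - t) * (√(1 + x ^ 2))⁻¹

theorem continuous_lineFactor (t : ℝ) : Continuous (lineFactor t) :=
  continuous_const.add (continuous_const.mul continuous_inv_sqrt_one_add_sq)

theorem lineFactor_pos {t : ℝ} (ht : t ∈ Icc (0 : ℝ) 1) (x : ℝ) : 0 < lineFactor t x := by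
  have h : 0 < (√(1 + x ^ 2))⁻¹ := by positivity
  obtain ⟨h0, h1⟩ := ht
  rcases h1.eq_or_lt with rfl | h1
  · simp [lineFactor]
  · have := mul_pos (sub_pos.mpr h1) h
    unfold lineFactor
    linarith

/-- For `x ≠ 0` and `t < 1`, `c_t(x)` averages `1` with a number below `1` that has positive weight.
The strict bound keeps `√(1 - y²)` away from zero in `liftFactor`; it fails at `t = 1`, `x = ±1`. -/
theorem sq_id_mul_lineFactor_lt {t : ℝ} (ht : t ∈ Ico (0 : ℝ) 1) {x : ℝ} (hx : |x| ≤ 1) :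
    (x * lineFactor t x) ^ 2 < 1 := by
  obtain ⟨h0, h1⟩ := ht
  have hp := lineFactor_pos ⟨h0, h1.le⟩ x
  rcases eq_or_ne x 0 with rfl | hx0
  · simp
  have h2 : (√(1 + x ^ 2))⁻¹ < 1 := by
    refine inv_lt_one_of_one_lt₀ ?_
    rw [Real.lt_sqrt zero_le_one]
    have : 0 < x ^ 2 := by positivity
    linarith
  have h3 : lineFactor t x < 1 := by
    have := mul_lt_mul_of_pos_left h2 (sub_pos.mpr h1)
    unfold lineFactor
    linarith
  rw [sq_lt_one_iff_abs_lt_one, abs_mul, abs_of_pos hp]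
  nlinarith [abs_nonneg x]

theorem cfc_id_mul_lineFactor {T : H →L[ℂ] H} (hT : IsSelfAdjoint T) (t : ℝ) :
    cfc (fun x => x * lineFactor t x) T = t • T + (1 - t) • cfc rieszFun T := by
  have e : (fun x => x * lineFactor t x) = fun x => t • x + (1 - t) • rieszFun x := by
    funext x
    simp only [lineFactor, rieszFun, smul_eq_mul]
    ring
  have := continuous_rieszFun
  rw [e, cfc_add (a := T) (fun x => t • x) (fun x => (1 - t) • rieszFun x),
    cfc_smul t (fun x => x) T, cfc_smul (1 - t) rieszFun T, cfc_id' ℝ T]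

/-- The factor `k_t` for which `x k_t(x)` is the image of `x c_t(x)` under the inverse
`y ↦ y / √(1 - y²)` of `rieszFun`. -/
def liftFactor (t x : ℝ) : ℝ := lineFactor t x * (√(1 - (x * lineFactor t x) ^ 2))⁻¹

theorem liftFactor_pos {t : ℝ} (ht : t ∈ Ico (0 : ℝ) 1) {x : ℝ} (hx : |x| ≤ 1) :
    0 < liftFactor t x :=
  mul_pos (lineFactor_pos ⟨ht.1, ht.2.le⟩ x)
    (inv_pos.mpr (Real.sqrt_pos.mpr (sub_pos.mpr (sq_id_mul_lineFactor_lt ht hx))))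

theorem continuousOn_liftFactor {t : ℝ} (ht : t ∈ Ico (0 : ℝ) 1) :
    ContinuousOn (liftFactor t) {x | |x| ≤ 1} := by
  have h := continuous_lineFactor t
  refine h.continuousOn.mul (ContinuousOn.inv₀ (by fun_prop) fun x hx => ?_)
  exact (Real.sqrt_pos.mpr (sub_pos.mpr (sq_id_mul_lineFactor_lt ht hx))).ne'

theorem rieszFun_div_sqrt {y : ℝ} (hy : y ^ 2 < 1) : rieszFun (y * (√(1 - y ^ 2))⁻¹) = y := by
  have h1 : 0 < 1 - y ^ 2 := sub_pos.mpr hy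
  have h2 : 1 + (y * (√(1 - y ^ 2))⁻¹) ^ 2 = (1 - y ^ 2)⁻¹ := by
    rw [mul_pow, inv_pow, Real.sq_sqrt h1.le]
    field_simp
    ring
  rw [rieszFun, h2, Real.sqrt_inv, inv_inv, mul_assoc, inv_mul_cancel₀ (Real.sqrt_pos.mpr h1).ne',
    mul_one]

theorem rieszFun_id_mul_liftFactor {t : ℝ} (ht : t ∈ Ico (0 : ℝ) 1) {x : ℝ} (hx : |x| ≤ 1) :
    rieszFun (x * liftFactor t x) = x * lineFactor t x := by
  rw [liftFactor, ← mul_assoc, rieszFun_div_sqrt (sq_id_mul_lineFactor_lt ht hx)]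

/-- At `t = 0` the point to lift is `rieszFun x`, whose lift is `x`; hence the lifted homotopy
starts at `F(T)`. -/
theorem liftFactor_zero (x : ℝ) : liftFactor 0 x = 1 := by
  have h : 0 < 1 + x ^ 2 := by positivity
  have h2 : 1 - (x * (√(1 + x ^ 2))⁻¹) ^ 2 = (1 + x ^ 2)⁻¹ := by
    rw [mul_pow, inv_pow, Real.sq_sqrt h.le]
    field_simp
    ring
  rw [liftFactor, lineFactor, zero_add, sub_zero, one_mul, h2, Real.sqrt_inv, inv_inv,
    inv_mul_cancel₀ (Real.sqrt_pos.mpr h).ne']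

theorem abs_le_one_of_mem_spectrum {S : H →L[ℂ] H} (hS : ‖S‖ ≤ 1) {x : ℝ}
    (hx : x ∈ spectrum ℝ S) : |x| ≤ 1 := by
  have h := spectrum.subset_closedBall_norm_mul (𝕜 := ℝ) S hx
  rw [mem_closedBall_zero_iff, Real.norm_eq_abs] at h
  -- The radius carries a factor `‖1‖`, which is only bounded by `1` since `H` may be trivial.
  exact h.trans (mul_le_one₀ hS (norm_nonneg _) ContinuousLinearMap.norm_id_le)

end FunctionalCalculus

/-! ### The two homotopies of pairs. -/

section Homotopies

variable {H : Type*} [NormedAddCommGroup H] [InnerProductSpace ℂ H] [CompleteSpace H]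

theorem continuous_cfc_val (f : ℝ → ℝ) (hf : Continuous f) :
    Continuous fun T : BoundedFredholmSA H => cfc f T.1 :=
  Continuous.cfc_of_mem_nhdsSet f Filter.univ_mem continuous_subtype_val
    (fun T => T.2.1) hf.continuousOn

theorem continuous_rieszTransform :
    Continuous fun T : ClosedFredholmSA H => rieszTransform T.1 T.2.1 :=
  continuous_induced_dom

theorem continuous_closedFredholmSA_iff {X : Type*} [TopologicalSpace X]
    {f : X → ClosedFredholmSA H} :
    Continuous f ↔ Continuous fun x => rieszTransform (f x).1 (f x).2.1 :=
  continuous_induced_rng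

theorem continuous_fredholmInclusion : Continuous (fredholmInclusion (H := H)) := by
  rw [continuous_closedFredholmSA_iff]
  exact (continuous_cfc_val _ continuous_rieszFun).congr fun T => (rieszTransform_toPMap T.2.1).symm

variable (H)

/-- The natural inclusion as a continuous map. -/
def inclusionMap : C(BoundedFredholmSA H, ClosedFredholmSA H) :=
  ⟨fredholmInclusion, continuous_fredholmInclusion⟩

/-- The Riesz transform as a continuous map from the unbounded to the bounded self-adjoint Fredholm
operators. -/
def rieszMap : C(ClosedFredholmSA H, BoundedFredholmSA H) :=
  ⟨fun T => ⟨rieszTransform T.1 T.2.1, isSelfAdjoint_rieszTransform T.2.1,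
    isFredholm_rieszTransform T.2.1 T.2.2⟩, continuous_rieszTransform.subtype_mk _⟩

theorem mapsTo_inclusionMap :
    MapsTo (inclusionMap H) (boundedInvertibleSA H) (closedInvertibleSA H) :=
  fun _ hT => isInvertibleOp_toPMap hT

theorem mapsTo_rieszMap :
    MapsTo (rieszMap H) (closedInvertibleSA H) (boundedInvertibleSA H) :=
  fun T hT => isUnit_rieszTransform T.2.1 hT

variable {H}

/-- The straight line from the Riesz transform of a bounded operator to the operator. -/
def lineHomotopy (p : unitInterval × BoundedFredholmSA H) : BoundedFredholmSA H :=
  ⟨cfc (fun x => x * lineFactor p.1 x) p.2.1, cfc_predicate _ _,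
    isFredholm_cfc_id_mul p.2.2.1 p.2.2.2 (continuous_lineFactor _).continuousOn
      fun x _ => (lineFactor_pos p.1.2 x).ne'⟩

theorem continuous_lineHomotopy : Continuous (lineHomotopy (H := H)) := by
  refine Continuous.subtype_mk ?_ _
  have h := (continuous_cfc_val (H := H) _ continuous_rieszFun).comp
    (continuous_snd (X := unitInterval))
  refine Continuous.congr ?_ fun p : unitInterval × BoundedFredholmSA H =>
    (cfc_id_mul_lineFactor p.2.2.1 p.1).symm
  have h1 : Continuous fun p : unitInterval × BoundedFredholmSA H => (1 - p.1 : ℝ) := by fun_prop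
  exact Continuous.add (by fun_prop) (h1.smul h)

theorem rieszMap_comp_inclusionMap_homotopicWith :
    ((rieszMap H).comp (inclusionMap H)).HomotopicWith (ContinuousMap.id _)
      (fun h => MapsTo h (boundedInvertibleSA H) (boundedInvertibleSA H)) := by
  refine ⟨⟨⟨⟨lineHomotopy, continuous_lineHomotopy⟩, fun T => ?_, fun T => ?_⟩, fun t T hT => ?_⟩⟩
  · refine Subtype.ext ?_
    change cfc (fun x => x * lineFactor (0 : ℝ) x) T.1 =
      rieszTransform _ (isSelfAdjoint_toPMap T.2.1)
    rw [cfc_id_mul_lineFactor T.2.1, rieszTransform_toPMap T.2.1]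
    simp
  · refine Subtype.ext ?_
    change cfc (fun x => x * lineFactor (1 : ℝ) x) T.1 = T.1
    rw [cfc_id_mul_lineFactor T.2.1]
    simp
  · exact isUnit_cfc_id_mul T.2.1 hT (continuous_lineFactor _).continuousOn
      fun x _ => (lineFactor_pos t.2 x).ne'

/-- The bounded operator whose Riesz transform is the point with parameter `t < 1` on the straight
line from `F(F(T))` to `F(T)`. -/
def liftOp (t : Ico (0 : ℝ) 1) (T : ClosedFredholmSA H) : BoundedFredholmSA H :=
  ⟨cfc (fun x => x * liftFactor t x) (rieszMap H T).1, cfc_predicate _ _,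
    isFredholm_cfc_id_mul (rieszMap H T).2.1 (rieszMap H T).2.2
      ((continuousOn_liftFactor t.2).mono fun _ hx =>
        abs_le_one_of_mem_spectrum (norm_rieszTransform_le T.2.1) hx)
      fun _ hx => (liftFactor_pos t.2
        (abs_le_one_of_mem_spectrum (norm_rieszTransform_le T.2.1) hx)).ne'⟩

theorem liftOp_mem {t : Ico (0 : ℝ) 1} {T : ClosedFredholmSA H} (hT : T ∈ closedInvertibleSA H) :
    liftOp t T ∈ boundedInvertibleSA H :=
  isUnit_cfc_id_mul (rieszMap H T).2.1 (mapsTo_rieszMap H hT)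
    ((continuousOn_liftFactor t.2).mono fun _ hx =>
      abs_le_one_of_mem_spectrum (norm_rieszTransform_le T.2.1) hx)
    fun _ hx => (liftFactor_pos t.2
      (abs_le_one_of_mem_spectrum (norm_rieszTransform_le T.2.1) hx)).ne'

theorem liftOp_zero (T : ClosedFredholmSA H) :
    liftOp ⟨0, left_mem_Ico.mpr one_pos⟩ T = rieszMap H T := by
  refine Subtype.ext ?_
  change cfc (fun x => x * liftFactor 0 x) (rieszMap H T).1 = (rieszMap H T).1
  simp only [liftFactor_zero, mul_one]
  exact cfc_id' ℝ _ (rieszMap H T).2.1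

/-- By the composition rule of the functional calculus, `rieszFun` undoes the lift on the spectrum
of `F(T)`, leaving `x c_t(x)`. -/
theorem rieszTransform_fredholmInclusion_liftOp (t : Ico (0 : ℝ) 1) (T : ClosedFredholmSA H) :
    rieszTransform (fredholmInclusion (liftOp t T)).1 (fredholmInclusion (liftOp t T)).2.1 =
      (t : ℝ) • (rieszMap H T).1 + (1 - t : ℝ) • cfc rieszFun (rieszMap H T).1 := by
  have hsp : ∀ x ∈ spectrum ℝ (rieszMap H T).1, |x| ≤ 1 := fun _ hx =>
    abs_le_one_of_mem_spectrum (norm_rieszTransform_le T.2.1) hx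
  have hsa := (rieszMap H T).2.1
  refine (rieszTransform_toPMap (liftOp t T).2.1).trans ?_
  change cfc rieszFun (cfc (fun x => x * liftFactor t x) (rieszMap H T).1) = _
  rw [← cfc_comp' rieszFun (fun x => x * liftFactor t x) (rieszMap H T).1
    continuous_rieszFun.continuousOn
    (continuousOn_id.mul ((continuousOn_liftFactor t.2).mono hsp)) hsa,
    ← cfc_id_mul_lineFactor hsa]
  exact cfc_congr fun x hx => rieszFun_id_mul_liftFactor t.2 (hsp x hx)

open Classical in
/-- The homotopy from `j ∘ F` to the identity that the Riesz transform maps to straight lines. -/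
def liftHomotopy (p : unitInterval × ClosedFredholmSA H) : ClosedFredholmSA H :=
  if h : (p.1 : ℝ) < 1 then fredholmInclusion (liftOp ⟨p.1, p.1.2.1, h⟩ p.2) else p.2

/-- One formula covers both branches: at `t = 1` the segment ends at `F(T)`, the transform of the
value `T` chosen there. Thus no separate limit argument is needed as `t → 1`. -/
theorem rieszTransform_liftHomotopy (p : unitInterval × ClosedFredholmSA H) :
    rieszTransform (liftHomotopy p).1 (liftHomotopy p).2.1 =
      (p.1 : ℝ) • (rieszMap H p.2).1 + (1 - p.1 : ℝ) • cfc rieszFun (rieszMap H p.2).1 := by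
  by_cases h : (p.1 : ℝ) < 1
  · have e : liftHomotopy p = fredholmInclusion (liftOp ⟨p.1, p.1.2.1, h⟩ p.2) := dif_pos h
    rw [e]
    exact rieszTransform_fredholmInclusion_liftOp _ _
  · have e : liftHomotopy p = p.2 := dif_neg h
    have h1 : (p.1 : ℝ) = 1 := le_antisymm p.1.2.2 (not_lt.mp h)
    rw [e, h1, sub_self, zero_smul, one_smul, add_zero]
    rfl

theorem continuous_liftHomotopy : Continuous (liftHomotopy (H := H)) := by
  rw [continuous_closedFredholmSA_iff]
  refine Continuous.congr ?_ fun p => (rieszTransform_liftHomotopy p).symm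
  have h := (continuous_cfc_val (H := H) _ continuous_rieszFun).comp
    ((rieszMap H).continuous.comp (continuous_snd (X := unitInterval)))
  have h1 : Continuous fun p : unitInterval × ClosedFredholmSA H => (p.1 : ℝ) := by fun_prop
  have h2 := (continuous_rieszTransform (H := H)).comp (continuous_snd (X := unitInterval))
  exact (h1.smul h2).add ((continuous_const.sub h1).smul h)

theorem inclusionMap_comp_rieszMap_homotopicWith :
    ((inclusionMap H).comp (rieszMap H)).HomotopicWith (ContinuousMap.id _)
      (fun h => MapsTo h (closedInvertibleSA H) (closedInvertibleSA H)) := by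
  refine ⟨⟨⟨⟨liftHomotopy, continuous_liftHomotopy⟩, fun T => ?_, fun T => ?_⟩, fun t T hT => ?_⟩⟩
  · have e : liftHomotopy ((0 : unitInterval), T) =
        fredholmInclusion (liftOp ⟨0, left_mem_Ico.mpr one_pos⟩ T) :=
      dif_pos (zero_lt_one (α := ℝ))
    change liftHomotopy ((0 : unitInterval), T) = fredholmInclusion (rieszMap H T)
    rw [e, liftOp_zero]
  · exact dif_neg (lt_irrefl (1 : ℝ))
  · change liftHomotopy (t, T) ∈ closedInvertibleSA H
    by_cases h : (t : ℝ) < 1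
    · have e : liftHomotopy (t, T) = fredholmInclusion (liftOp ⟨t, t.2.1, h⟩ T) := dif_pos h
      rw [e]
      exact mapsTo_inclusionMap H (liftOp_mem hT)
    · have e : liftHomotopy (t, T) = T := dif_neg h
      rwa [e]

end Homotopies

end RieszFredholm

end

theorem mainTheorem4 {H : Type*} [NormedAddCommGroup H] [InnerProductSpace ℂ H] [CompleteSpace H]
    [TopologicalSpace.SeparableSpace H] :
    RieszFredholm.IsPairHomotopyEquiv
      (RieszFredholm.boundedInvertibleSA H) (RieszFredholm.closedInvertibleSA H)
      (RieszFredholm.fredholmInclusion (H := H)) :=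
  ⟨RieszFredholm.inclusionMap H, fun _ => rfl, RieszFredholm.mapsTo_inclusionMap H,
    RieszFredholm.rieszMap H, RieszFredholm.mapsTo_rieszMap H,
    RieszFredholm.rieszMap_comp_inclusionMap_homotopicWith,
    RieszFredholm.inclusionMap_comp_rieszMap_homotopicWith⟩
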